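/- Fix $\alpha>1$, $\beta\in\mathbb{R}$ and $\sigma\ge 0$. Regard $[0,2\pi)$ as a circle, let $\mathbb{P}$ be normalised Lebesgue measure on it, and let $g(\theta)=3\theta \pmod{2\pi}$. For $x\in\overline{\mathbb{R}}=[-\infty,\infty]$ (with $\arctan(\pm\infty)=\pm\pi/2$) let $$f_{\beta,\sigma,\theta}(x)=\alpha\arctan(x)+\beta+\sigma\cos\theta,\qquad f_{\beta,\sigma,\theta,n}=f_{\beta,\sigma,g^{n-1}(\theta)}\circ\cdots\circ f_{\beta,\sigma,g(\theta)}\circ f_{\beta,\sigma,\theta}\quad(n\ge 0),$$ and let $G_{\beta,\sigma}(x,\theta)=(f_{\beta,\sigma,\theta}(x),g(\theta))$ on $\mathbb{R}\times[0,2\pi)$. For $n\ge1$ let $X_{\beta,\sigma,n}(\theta)=f_{\beta,\sigma,\theta,n}(\infty)-f_{\beta,\sigma,\theta,n}(-\infty)$, the width of the $n$-th image of $\mathbb{R}\times\{\theta\}$ under $G_{\beta,\sigma}$. Let $\Theta=\{(\theta_i)_{i\in\mathbb{Z}} : \theta_{i+1}=g(\theta_i)\ \forall i\}$, and let $\tilde{\mathbb{P}}$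 be the unique probability measure on $\Theta$ all of whose one-dimensional marginals are $\mathbb{P}$. Let $\Theta_{\beta,\sigma}$ be the set of $\boldsymbol\theta=(\theta_i)_i\in\Theta$ for which $\bigcap_{n\ge0} f_{\beta,\sigma,\theta_{-n},n}(\overline{\mathbb{R}})$ is a singleton, and for such $\boldsymbol\theta$ write this singleton as $\{a_{\beta,\sigma}(\boldsymbol\theta)\}$. **Proposition.** The following statements are equivalent: (i) $\tilde{\mathbb{P}}(\Theta_{\beta,\sigma})=1$; (ii) over the probability space $([0,2\pi),\mathbb{P})$, $X_{\beta,\sigma,n}$ converges in probability to $0$ as $n\to\infty$; (iii) there is exactly one $G_{\beta,\sigma}$-invariant measure on $\mathbb{R}\times[0,2\pi)$ with $\theta$-marginal $\mathbb{P}$. If these statements hold, then the unique $G_{\beta,\sigma}$-invariant measure with $\theta$-marginal $\mathbb{P}$ is $\mu_{\beta,\sigma}$, the pushforward of $\tilde{\mathbb{P}}$ under $\boldsymbol\theta\mapsto(a_{\beta,\sigma}(\boldsymbol\theta),\theta_0)$. -/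

import Mathlib

open MeasureTheory Filter Topology Set

noncomputable section

namespace ForcedMap

instance factTwoPiPos : Fact (0 < 2 * Real.pi) := ⟨Real.two_pi_pos⟩

/-- The interval `[0, 2π)` wrapped round as a circle. -/
abbrev Circ : Type := AddCircle (2 * Real.pi)

/-- Normalised Lebesgue measure on `[0, 2π)`. -/
def P : Measure Circ := AddCircle.haarAddCircle

/-- The tripling map `g(θ) = 3θ (mod 2π)`. -/
def g (θ : Circ) : Circ := 3 • θ

/-- The cosine, as a function on the circle. -/
def cosC : Circ → ℝ := Real.cos_periodic.lift

/-- The arctangent on the extended real line, with values `±π/2` at `±∞`. -/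
def atanE (x : EReal) : ℝ :=
  if x = ⊤ then Real.pi / 2 else if x = ⊥ then -(Real.pi / 2) else Real.arctan x.toReal

/-- The fibre map `f_{β,σ,θ}(x) = α arctan x + β + σ cos θ`, from the extended reals to the reals. -/
def f (α β σ : ℝ) (θ : Circ) (x : EReal) : ℝ := α * atanE x + β + σ * cosC θ

/-- The composition `f_{β,σ,θ,n} = f_{β,σ,g^{n-1}(θ)} ∘ ⋯ ∘ f_{β,σ,g(θ)} ∘ f_{β,σ,θ}`
(the identity for `n = 0`). -/
def fIter (α β σ : ℝ) (θ : Circ) : ℕ → EReal → EReal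
  | 0, x => x
  | n + 1, x => (f α β σ (g^[n] θ) (fIter α β σ θ n x) : EReal)

/-- The skew product map `G_{β,σ}(x, θ) = (f_{β,σ,θ}(x), g(θ))`. -/
def G (α β σ : ℝ) (p : ℝ × Circ) : ℝ × Circ := (f α β σ p.2 (p.1 : EReal), g p.2)

/-- The width `X_{β,σ,n}(θ) = f_{β,σ,θ,n}(∞) - f_{β,σ,θ,n}(-∞)` of the `n`-th image of the fibre over
`θ`. For `n ≥ 1` both terms are real numbers; the value at `n = 0` is irrelevant. -/
def X (α β σ : ℝ) (n : ℕ) (θ : Circ) : ℝ :=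
  (fIter α β σ θ n ⊤).toReal - (fIter α β σ θ n ⊥).toReal

/-- `μ` is a `G_{β,σ}`-invariant measure whose `θ`-marginal is `P`
(in particular it is a probability measure). -/
def IsInvariantOver (α β σ : ℝ) (μ : Measure (ℝ × Circ)) : Prop :=
  MeasurePreserving (G α β σ) μ μ ∧ μ.map Prod.snd = P

/-- The space `Θ` of two-sided orbits of `g`. -/
abbrev Orbit : Type := {θ : ℤ → Circ // ∀ i, θ (i + 1) = g (θ i)}

/-- The two-sided orbits form a compact subgroup of the group of all two-sided sequences. -/
def orbitSubgroup : AddSubgroup (ℤ → Circ) where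
  carrier := {θ | ∀ i, θ (i + 1) = g (θ i)}
  add_mem' := by
    intro a b ha hb i
    simp only [mem_ofPred_eq, g, Pi.add_apply] at *
    rw [ha, hb, smul_add]
  zero_mem' := by intro i; simp [g]
  neg_mem' := by
    intro a ha i
    simp only [mem_ofPred_eq, g, Pi.neg_apply] at *
    rw [ha, smul_neg]

theorem continuous_g : Continuous g := by unfold g; fun_prop

theorem isClosed_orbit : IsClosed {θ : ℤ → Circ | ∀ i, θ (i + 1) = g (θ i)} := by
  simp only [ofPred_forall]
  exact isClosed_iInter fun i =>
    isClosed_eq (continuous_apply _) (continuous_g.comp (continuous_apply _))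

theorem exists_div_three (θ : Circ) : ∃ η : Circ, g η = θ := by
  induction θ using QuotientAddGroup.induction_on with
  | H x =>
    refine ⟨((x / 3 : ℝ) : Circ), ?_⟩
    unfold g
    rw [← AddCircle.coe_nsmul]
    congr 1
    simp
    ring

theorem exists_orbit (k : ℤ) (θ : Circ) : ∃ o : Orbit, o.1 k = θ := by
  choose d hd using exists_div_three
  refine ⟨⟨fun i => if k ≤ i then g^[(i - k).toNat] θ else d^[(k - i).toNat] θ, fun i => ?_⟩, ?_⟩
  · rcases lt_trichotomy (i + 1) k with h | h | h
    · have h1 : ¬ k ≤ i + 1 := by omega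
      have h2 : ¬ k ≤ i := by omega
      have h3 : (k - i).toNat = (k - (i + 1)).toNat + 1 := by omega
      simp only [h1, h2, if_false]
      rw [h3, Function.iterate_succ_apply', hd]
    · have h1 : k ≤ i + 1 := by omega
      have h2 : ¬ k ≤ i := by omega
      have h3 : (k - i).toNat = 1 := by omega
      have h4 : (i + 1 - k).toNat = 0 := by omega
      simp only [h1, h2, if_false, if_true, h3, h4, Function.iterate_zero, Function.iterate_one,
        id_eq, hd]
    · have h1 : k ≤ i + 1 := by omega
      have h2 : k ≤ i := by omega
      have h3 : (i + 1 - k).toNat = (i - k).toNat + 1 := by omega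
      simp only [h1, h2, if_true]
      rw [h3, Function.iterate_succ_apply']
  · simp

theorem exists_orbitMeasure :
    ∃ μ : Measure Orbit, IsProbabilityMeasure μ ∧ ∀ i : ℤ, μ.map (fun o => o.1 i) = P := by
  have : CompactSpace orbitSubgroup := isCompact_iff_compactSpace.mp isClosed_orbit.isCompact
  have : BorelSpace orbitSubgroup := Subtype.borelSpace _
  let K : TopologicalSpace.PositiveCompacts orbitSubgroup := ⊤
  let μ : Measure orbitSubgroup := Measure.addHaarMeasure K
  have hμ : IsProbabilityMeasure μ := ⟨Measure.addHaarMeasure_self⟩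
  refine ⟨μ, hμ, fun i => ?_⟩
  let e : orbitSubgroup →+ Circ := (Pi.evalAddMonoidHom (fun _ : ℤ => Circ) i).comp
    orbitSubgroup.subtype
  have hc : Continuous e := (continuous_apply i).comp continuous_subtype_val
  have hs : Function.Surjective e := fun θ => by
    obtain ⟨o, ho⟩ := exists_orbit i θ
    exact ⟨⟨o.1, o.2⟩, ho⟩
  have : (AddCircle.haarAddCircle : Measure Circ).IsAddHaarMeasure := by
    unfold AddCircle.haarAddCircle; infer_instance
  exact (AddMonoidHom.measurePreserving (μ := μ) (ν := (AddCircle.haarAddCircle : Measure Circ))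
    hc hs (by simp)).map_eq

theorem orbit_iterate (o : Orbit) (i : ℤ) (n : ℕ) : o.1 (i + n) = g^[n] (o.1 i) := by
  induction n with
  | zero => simp
  | succ n ih =>
    rw [Function.iterate_succ_apply', ← ih, ← o.2 (i + n)]
    push_cast
    ring_nf

theorem orbitMeasure_unique {μ ν : Measure Orbit} [IsProbabilityMeasure μ] [IsProbabilityMeasure ν]
    (hμ : ∀ i : ℤ, μ.map (fun o => o.1 i) = P) (hν : ∀ i : ℤ, ν.map (fun o => o.1 i) = P) :
    μ = ν := by
  have hm : ∀ i : ℤ, Measurable fun o : Orbit => o.1 i := fun i =>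
    (measurable_pi_apply i).comp measurable_subtype_coe
  have hgn : ∀ n, Measurable g^[n] := fun n => (continuous_g.iterate n).measurable
  let C : Set (Set Orbit) :=
    {s | ∃ (n : ℕ) (A : Set Circ), MeasurableSet A ∧ s = (fun o : Orbit => o.1 (-(n : ℤ))) ⁻¹' A}
  have hshift : ∀ (i j : ℤ) (k : ℕ), i + k = j → ∀ A : Set Circ,
      (fun o : Orbit => o.1 j) ⁻¹' A = (fun o : Orbit => o.1 i) ⁻¹' (g^[k] ⁻¹' A) := by
    intro i j k h A
    ext o
    simp only [mem_preimage]
    rw [← h, orbit_iterate]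
  refine ext_of_generate_finite C ?_ ?_ ?_ (by simp)
  · apply le_antisymm
    · change MeasurableSpace.comap _ (⨆ i, MeasurableSpace.comap _ _) ≤ _
      rw [MeasurableSpace.comap_iSup]
      refine iSup_le fun i => ?_
      rw [MeasurableSpace.comap_comp]
      rintro s ⟨A, hA, rfl⟩
      refine MeasurableSpace.measurableSet_generateFrom
        ⟨i.natAbs, g^[(i + i.natAbs).toNat] ⁻¹' A, hgn _ hA, ?_⟩
      exact hshift (-(i.natAbs : ℤ)) i _ (by omega) A
    · refine MeasurableSpace.generateFrom_le ?_
      rintro s ⟨n, A, hA, rfl⟩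
      exact hm _ hA
  · rintro s ⟨n, A, hA, rfl⟩ t ⟨m, B, hB, rfl⟩ -
    refine ⟨n + m, g^[m] ⁻¹' A ∩ g^[n] ⁻¹' B, (hgn _ hA).inter (hgn _ hB), ?_⟩
    rw [preimage_inter,
      hshift (-((n + m : ℕ) : ℤ)) (-(n : ℤ)) m (by push_cast; ring) A,
      hshift (-((n + m : ℕ) : ℤ)) (-(m : ℤ)) n (by push_cast; ring) B]
  · rintro s ⟨n, A, hA, rfl⟩
    rw [← Measure.map_apply (hm _) hA, ← Measure.map_apply (hm _) hA, hμ, hν]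

theorem existsUnique_orbitMeasure :
    ∃! μ : Measure Orbit, IsProbabilityMeasure μ ∧ ∀ i : ℤ, μ.map (fun o => o.1 i) = P := by
  obtain ⟨μ, hμ, h⟩ := exists_orbitMeasure
  refine ⟨μ, ⟨hμ, h⟩, ?_⟩
  rintro ν ⟨hν, h'⟩
  exact orbitMeasure_unique h' h

/-- The measure `P̃`: the unique probability measure on the space of two-sided orbits all of whose
one-dimensional marginals are `P`. -/
def Ptilde : Measure Orbit := existsUnique_orbitMeasure.choose

theorem Ptilde_spec :
    IsProbabilityMeasure Ptilde ∧ ∀ i : ℤ, Ptilde.map (fun o => o.1 i) = P :=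
  existsUnique_orbitMeasure.choose_spec.1

/-- The intersection over `n ≥ 0` of the sets `f_{β,σ,θ_{-n},n}([-∞, ∞])`. -/
def pullbackSet (α β σ : ℝ) (o : Orbit) : Set EReal :=
  ⋂ n : ℕ, range (fIter α β σ (o.1 (-(n : ℤ))) n)

/-- The set `Θ_{β,σ}` of two-sided orbits whose pullback set is a singleton; the point is
automatically real. -/
def singletonOrbits (α β σ : ℝ) : Set Orbit :=
  {o | ∃ a : ℝ, pullbackSet α β σ o = {(a : EReal)}}

open Classical in
/-- The function `a_{β,σ}` on `Θ_{β,σ}`: the unique point of the pullback set (and `0` off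
`Θ_{β,σ}`). -/
def a (α β σ : ℝ) (o : Orbit) : ℝ :=
  if h : ∃ a : ℝ, pullbackSet α β σ o = {(a : EReal)} then h.choose else 0

/-- The set `D̃` of parameters `(β, σ) ∈ ℝ × [0, ∞)` with `P̃(Θ_{β,σ}) = 1`. -/
def Dtilde (α : ℝ) : Set (ℝ × ℝ) :=
  {p | 0 ≤ p.2 ∧ Ptilde (singletonOrbits α p.1 p.2) = 1}

/-- The measure `μ_{β,σ}`: the pushforward of `P̃` under `o ↦ (a_{β,σ}(o), o_0)`. -/
def muD (α β σ : ℝ) : Measure (ℝ × Circ) :=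
  Ptilde.map fun o => (a α β σ o, o.1 0)

end ForcedMap

end

noncomputable section

namespace ForcedMap

/-! ### The fibre maps -/

/-! Each fibre map is monotone and bounded, so the images of the whole fibre started ever further in
the past lie in nested intervals, whose ends converge to `lower` and `upper`. Both limits lie in the
pullback set, so (i) says exactly that `lower = upper` almost surely. For (ii): marginals of
`Ptilde` are `P`, so `X` has the law of the pullback width, and that width converges pointwise to
`upper - lower`. For (iii): `lower` and `upper` are equivariant, so each yields an invariant
measure. If there is only one, the two laws agree, and with `lower ≤ upper` this forces equality
almost everywhere (`ae_eq_of_map_eq`). Conversely, monotonicity squeezes any invariant measure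
between the two (`map_upper_Iio_le`, `map_lower_Ioi_le`), so it is determined once they coincide. -/

theorem continuous_cosC : Continuous cosC :=
  continuous_coinduced_dom.mpr Real.continuous_cos

theorem abs_cosC_le_one (θ : Circ) : |cosC θ| ≤ 1 := by
  induction θ using QuotientAddGroup.induction_on with
  | H x => exact Real.abs_cos_le_one x

@[simp] theorem atanE_coe (x : ℝ) : atanE x = Real.arctan x := by simp [atanE]

@[simp] theorem atanE_top : atanE ⊤ = Real.pi / 2 := by simp [atanE]

@[simp] theorem atanE_bot : atanE ⊥ = -(Real.pi / 2) := by simp [atanE]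

theorem atanE_mem_Icc (x : EReal) : atanE x ∈ Icc (-(Real.pi / 2)) (Real.pi / 2) := by
  have := Real.pi_pos
  induction x using EReal.rec with
  | bot => rw [atanE_bot]; constructor <;> linarith
  | top => rw [atanE_top]; constructor <;> linarith
  | coe x =>
    rw [atanE_coe]
    exact ⟨(Real.neg_pi_div_two_lt_arctan x).le, (Real.arctan_lt_pi_div_two x).le⟩

theorem monotone_atanE : Monotone atanE := by
  intro x y hxy
  induction x using EReal.rec with
  | bot => rw [atanE_bot]; exact (atanE_mem_Icc y).1
  | top => rw [top_le_iff.mp hxy]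
  | coe x =>
    induction y using EReal.rec with
    | bot => simp at hxy
    | top => rw [atanE_top]; exact (atanE_mem_Icc _).2
    | coe y =>
      rw [atanE_coe, atanE_coe]
      exact Real.arctan_strictMono.monotone (EReal.coe_le_coe_iff.mp hxy)

theorem measurable_atanE : Measurable atanE :=
  Measurable.ite (measurableSet_singleton _) measurable_const <|
    Measurable.ite (measurableSet_singleton _) measurable_const <|
      Real.measurable_arctan.comp measurable_ereal_toReal

theorem measurable_g : Measurable g := continuous_g.measurable

theorem measurable_eval (i : ℤ) : Measurable fun o : Orbit => o.1 i :=
  (measurable_pi_apply i).comp measurable_subtype_coe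

variable {α β σ : ℝ}

theorem monotone_f (hα : 0 ≤ α) (θ : Circ) : Monotone (f α β σ θ) := fun x y hxy => by
  have := mul_le_mul_of_nonneg_left (monotone_atanE hxy) hα
  unfold f
  linarith

theorem abs_f_le (θ : Circ) (x : EReal) :
    |f α β σ θ x| ≤ |α| * (Real.pi / 2) + |β| + |σ| := by
  have h1 : |atanE x| ≤ Real.pi / 2 := abs_le.mpr (atanE_mem_Icc x)
  have h2 := abs_cosC_le_one θ
  calc |f α β σ θ x| ≤ |α * atanE x| + |β| + |σ * cosC θ| := abs_add_three _ _ _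
    _ ≤ |α| * (Real.pi / 2) + |β| + |σ| := by
      rw [abs_mul, abs_mul]
      gcongr
      exact mul_le_of_le_one_right (abs_nonneg _) h2

theorem measurable_f_comp {Ω : Type*} [MeasurableSpace Ω] {u : Ω → Circ} {v : Ω → EReal}
    (hu : Measurable u) (hv : Measurable v) : Measurable fun ω => f α β σ (u ω) (v ω) :=
  (((measurable_atanE.comp hv).const_mul α).add_const β).add
    ((continuous_cosC.measurable.comp hu).const_mul σ)

theorem measurable_G : Measurable (G α β σ) :=
  (measurable_f_comp measurable_snd (measurable_coe_real_ereal.comp measurable_fst)).prodMk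
    (measurable_g.comp measurable_snd)

theorem tendsto_f {ι : Type*} {l : Filter ι} {u : ι → ℝ} {b : ℝ} (θ : Circ)
    (h : Tendsto u l (𝓝 b)) :
    Tendsto (fun i => f α β σ θ (u i)) l (𝓝 (f α β σ θ b)) := by
  simp only [f, atanE_coe]
  exact (((Real.continuous_arctan.tendsto b).comp h).const_mul α |>.add_const β).add_const _

/-! ### Iterates -/

/-- The definition splits off the outermost map. Pullback arguments need the innermost one, since
starting earlier prepends a map. -/
theorem fIter_succ' (θ : Circ) (n : ℕ) (x : EReal) :
    fIter α β σ θ (n + 1) x = fIter α β σ (g θ) n (f α β σ θ x) := by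
  induction n with
  | zero => rfl
  | succ n ih =>
    rw [fIter, ih]
    simp only [fIter, Function.iterate_succ_apply]

theorem monotone_fIter (hα : 0 ≤ α) (θ : Circ) (n : ℕ) : Monotone (fIter α β σ θ n) := by
  induction n with
  | zero => exact monotone_id
  | succ n ih => exact fun x y hxy => EReal.coe_le_coe_iff.mpr (monotone_f hα _ (ih hxy))

theorem measurable_fIter (n : ℕ) (x : EReal) : Measurable fun θ => fIter α β σ θ n x := by
  induction n with
  | zero => exact measurable_const
  | succ n ih =>
    exact measurable_coe_real_ereal.comp
      (measurable_f_comp (continuous_g.iterate n).measurable ih)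

variable (α β σ) in
/-- The real number `f_{β,σ,θ,n+1}(x)`. -/
def iterVal (n : ℕ) (θ : Circ) (x : EReal) : ℝ := f α β σ (g^[n] θ) (fIter α β σ θ n x)

theorem fIter_succ_eq (θ : Circ) (n : ℕ) (x : EReal) :
    fIter α β σ θ (n + 1) x = iterVal α β σ n θ x := rfl

theorem iterVal_succ (n : ℕ) (θ : Circ) (x : EReal) :
    iterVal α β σ (n + 1) θ x = f α β σ (g^[n + 1] θ) (iterVal α β σ n θ x) := rfl

theorem iterVal_succ' (n : ℕ) (θ : Circ) (x : EReal) :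
    iterVal α β σ (n + 1) θ x = iterVal α β σ n (g θ) (f α β σ θ x) := by
  rw [iterVal, fIter_succ', Function.iterate_succ_apply, iterVal]

theorem monotone_iterVal (hα : 0 ≤ α) (n : ℕ) (θ : Circ) : Monotone (iterVal α β σ n θ) :=
  fun _ _ hxy => monotone_f hα _ (monotone_fIter hα θ n hxy)

theorem measurable_iterVal (n : ℕ) (x : EReal) : Measurable fun θ => iterVal α β σ n θ x :=
  measurable_f_comp (continuous_g.iterate n).measurable (measurable_fIter n x)

theorem iterate_G (n : ℕ) (p : ℝ × Circ) :
    (G α β σ)^[n + 1] p = (iterVal α β σ n p.2 p.1, g^[n + 1] p.2) := by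
  induction n with
  | zero => rfl
  | succ n ih =>
    rw [Function.iterate_succ_apply', ih, G, ← iterVal_succ, ← Function.iterate_succ_apply' g]

/-! ### Pullback iterates and their limits -/

variable (α β σ) in
/-- The value at `x` of the composition of the last `n + 1` fibre maps before time `0`. -/
def pullIter (x : EReal) (n : ℕ) (o : Orbit) : ℝ :=
  iterVal α β σ n (o.1 (-((n + 1 : ℕ) : ℤ))) x

theorem measurable_pullIter (x : EReal) (n : ℕ) : Measurable (pullIter α β σ x n) :=
  (measurable_iterVal n x).comp (measurable_eval _)

theorem pullIter_succ (x : EReal) (n : ℕ) (o : Orbit) :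
    pullIter α β σ x (n + 1) o = iterVal α β σ n (o.1 (-((n + 1 : ℕ) : ℤ)))
      (f α β σ (o.1 (-((n + 1 + 1 : ℕ) : ℤ))) x) := by
  have h : -((n + 1 : ℕ) : ℤ) = -((n + 1 + 1 : ℕ) : ℤ) + 1 := by push_cast; ring
  rw [pullIter, iterVal_succ', h, o.2]

theorem antitone_pullIter_top (hα : 0 ≤ α) (o : Orbit) :
    Antitone fun n => pullIter α β σ ⊤ n o :=
  antitone_nat_of_succ_le fun n => by
    rw [pullIter_succ]
    exact monotone_iterVal hα n _ le_top

theorem monotone_pullIter_bot (hα : 0 ≤ α) (o : Orbit) :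
    Monotone fun n => pullIter α β σ ⊥ n o :=
  monotone_nat_of_le_succ fun n => by
    rw [pullIter_succ]
    exact monotone_iterVal hα n _ bot_le

theorem abs_pullIter_le (x : EReal) (n : ℕ) (o : Orbit) :
    |pullIter α β σ x n o| ≤ |α| * (Real.pi / 2) + |β| + |σ| := abs_f_le _ _

variable (α β σ) in
/-- The upper end of the pullback set. -/
def upper (o : Orbit) : ℝ := ⨅ n, pullIter α β σ ⊤ n o

variable (α β σ) in
/-- The lower end of the pullback set. -/
def lower (o : Orbit) : ℝ := ⨆ n, pullIter α β σ ⊥ n o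

theorem bddBelow_range_pullIter (x : EReal) (o : Orbit) :
    BddBelow (range fun n => pullIter α β σ x n o) :=
  ⟨_, by rintro _ ⟨n, rfl⟩; exact (abs_le.mp (abs_pullIter_le x n o)).1⟩

theorem bddAbove_range_pullIter (x : EReal) (o : Orbit) :
    BddAbove (range fun n => pullIter α β σ x n o) :=
  ⟨_, by rintro _ ⟨n, rfl⟩; exact (abs_le.mp (abs_pullIter_le x n o)).2⟩

theorem tendsto_upper (hα : 0 ≤ α) (o : Orbit) :
    Tendsto (fun n => pullIter α β σ ⊤ n o) atTop (𝓝 (upper α β σ o)) :=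
  tendsto_atTop_ciInf (antitone_pullIter_top hα o) (bddBelow_range_pullIter ⊤ o)

theorem tendsto_lower (hα : 0 ≤ α) (o : Orbit) :
    Tendsto (fun n => pullIter α β σ ⊥ n o) atTop (𝓝 (lower α β σ o)) :=
  tendsto_atTop_ciSup (monotone_pullIter_bot hα o) (bddAbove_range_pullIter ⊥ o)

theorem lower_le_upper (hα : 0 ≤ α) (o : Orbit) : lower α β σ o ≤ upper α β σ o :=
  le_of_tendsto_of_tendsto' (tendsto_lower hα o) (tendsto_upper hα o) fun n =>
    monotone_iterVal hα n _ bot_le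

theorem measurable_upper : Measurable (upper α β σ) :=
  .iInf fun n => measurable_pullIter ⊤ n

theorem measurable_lower : Measurable (lower α β σ) :=
  .iSup fun n => measurable_pullIter ⊥ n

/-! ### The shift on two-sided orbits -/

/-- The shift by `k` on two-sided orbits. -/
def shift (k : ℤ) (o : Orbit) : Orbit :=
  ⟨fun i => o.1 (i + k), fun i => by
    simpa only [add_right_comm] using o.2 (i + k)⟩

theorem measurable_shift (k : ℤ) : Measurable (shift k) :=
  (measurable_pi_lambda _ fun i => measurable_eval (i + k)).subtype_mk

theorem measurePreserving_eval (i : ℤ) : MeasurePreserving (fun o : Orbit => o.1 i) Ptilde P :=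
  ⟨measurable_eval i, Ptilde_spec.2 i⟩

instance isProbabilityMeasure_Ptilde : IsProbabilityMeasure Ptilde := Ptilde_spec.1

instance isProbabilityMeasure_P : IsProbabilityMeasure P := by unfold P; infer_instance

/-- The shifted measure again has all marginals `P`, so uniqueness applies. -/
theorem measurePreserving_shift (k : ℤ) : MeasurePreserving (shift k) Ptilde Ptilde := by
  refine ⟨measurable_shift k, ?_⟩
  have : IsProbabilityMeasure (Ptilde.map (shift k)) :=
    Measure.isProbabilityMeasure_map (measurable_shift k).aemeasurable
  refine orbitMeasure_unique (fun i => ?_) Ptilde_spec.2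
  rw [Measure.map_map (measurable_eval i) (measurable_shift k)]
  exact Ptilde_spec.2 (i + k)

/-- A function on two-sided orbits whose graph over the zeroth coordinate is invariant under the
skew product. -/
def IsEquivariant (α β σ : ℝ) (u : Orbit → ℝ) : Prop :=
  ∀ o, u (shift 1 o) = f α β σ (o.1 0) (u o)

/-- A pullback over the shifted orbit is the pullback over `o`, one step shorter, followed by the
map at time `0`. Continuity of that map carries this to the limit. -/
theorem isEquivariant_of_tendsto {x : EReal} {u : Orbit → ℝ}
    (h : ∀ o, Tendsto (fun n => pullIter α β σ x n o) atTop (𝓝 (u o))) :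
    IsEquivariant α β σ u := fun o => by
  refine tendsto_nhds_unique ((tendsto_add_atTop_iff_nat 1).mpr (h (shift 1 o))) ?_
  convert tendsto_f (o.1 0) (h o) using 2 with n
  have h1 : (shift 1 o).1 (-((n + 1 + 1 : ℕ) : ℤ)) = o.1 (-((n + 1 : ℕ) : ℤ)) :=
    congrArg o.1 (by push_cast; ring)
  rw [pullIter, h1, iterVal_succ, ← orbit_iterate, neg_add_cancel]
  rfl

theorem IsEquivariant.shift_nat {u : Orbit → ℝ} (hu : IsEquivariant α β σ u) (n : ℕ) (o : Orbit) :
    (u (shift n o) : EReal) = fIter α β σ (o.1 0) n (u o) := by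
  induction n with
  | zero =>
    have : shift ((0 : ℕ) : ℤ) o = o := Subtype.ext (funext fun i => by simp [shift])
    rw [this, fIter]
  | succ n ih =>
    have : shift ((n + 1 : ℕ) : ℤ) o = shift 1 (shift n o) :=
      Subtype.ext (funext fun i => congrArg o.1 (by push_cast; ring))
    rw [this, hu, fIter, ← ih, ← orbit_iterate]
    simp [shift]

theorem IsEquivariant.mem_pullbackSet {u : Orbit → ℝ} (hu : IsEquivariant α β σ u) (o : Orbit) :
    (u o : EReal) ∈ pullbackSet α β σ o := by
  refine mem_iInter.mpr fun n => ⟨u (shift (-n) o), ?_⟩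
  have h := hu.shift_nat n (shift (-n) o)
  have h1 : shift n (shift (-n) o) = o := Subtype.ext (funext fun i => by simp [shift])
  rw [h1] at h
  rw [h]
  simp [shift]

theorem isEquivariant_upper (hα : 0 ≤ α) : IsEquivariant α β σ (upper α β σ) :=
  isEquivariant_of_tendsto (tendsto_upper hα)

theorem isEquivariant_lower (hα : 0 ≤ α) : IsEquivariant α β σ (lower α β σ) :=
  isEquivariant_of_tendsto (tendsto_lower hα)

theorem pullbackSet_eq_singleton (hα : 0 ≤ α) {o : Orbit} (h : lower α β σ o = upper α β σ o) :
    pullbackSet α β σ o = {(upper α β σ o : EReal)} := by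
  refine Subset.antisymm (fun y hy => ?_)
    (singleton_subset_iff.mpr ((isEquivariant_upper hα).mem_pullbackSet o))
  have hy' := mem_iInter.mp hy
  -- Index `0` gives all of `EReal`. Index `1` already shows that the point is real.
  obtain ⟨x₁, rfl⟩ := hy' (0 + 1)
  rw [fIter_succ_eq] at hy' ⊢
  set r := iterVal α β σ 0 (o.1 (-((0 + 1 : ℕ) : ℤ))) x₁
  have key : ∀ n, pullIter α β σ ⊥ n o ≤ r ∧ r ≤ pullIter α β σ ⊤ n o := fun n => by
    obtain ⟨x, hx⟩ := hy' (n + 1)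
    rw [fIter_succ_eq, EReal.coe_eq_coe_iff] at hx
    rw [← hx]
    exact ⟨monotone_iterVal hα n _ bot_le, monotone_iterVal hα n _ le_top⟩
  have h1 := le_of_tendsto' (tendsto_lower hα o) fun n => (key n).1
  have h2 := ge_of_tendsto' (tendsto_upper hα o) fun n => (key n).2
  rw [mem_singleton_iff, EReal.coe_eq_coe_iff]
  exact le_antisymm h2 (h ▸ h1)

/-- Equivariance puts both ends in the pullback set, so a singleton forces them to agree. -/
theorem singletonOrbits_eq (hα : 0 ≤ α) :
    singletonOrbits α β σ = {o | lower α β σ o = upper α β σ o} := by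
  ext o
  refine ⟨fun ⟨b, hb⟩ => ?_, fun h => ⟨_, pullbackSet_eq_singleton hα h⟩⟩
  have h1 := (isEquivariant_lower (β := β) (σ := σ) hα).mem_pullbackSet o
  have h2 := (isEquivariant_upper (β := β) (σ := σ) hα).mem_pullbackSet o
  rw [hb, mem_singleton_iff] at h1 h2
  exact EReal.coe_eq_coe_iff.mp (h1.trans h2.symm)

theorem a_eq_upper (hα : 0 ≤ α) {o : Orbit} (h : lower α β σ o = upper α β σ o) :
    a α β σ o = upper α β σ o := by
  have hs := pullbackSet_eq_singleton hα h
  have hex : ∃ b : ℝ, pullbackSet α β σ o = {(b : EReal)} := ⟨_, hs⟩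
  rw [a, dif_pos hex]
  exact (EReal.coe_eq_coe_iff.mp (singleton_injective (hs.symm.trans hex.choose_spec))).symm

theorem mem_Dtilde_iff (hα : 0 ≤ α) (hσ : 0 ≤ σ) :
    (β, σ) ∈ Dtilde α ↔ lower α β σ =ᵐ[Ptilde] upper α β σ := by
  have hm : MeasurableSet {o | lower α β σ o = upper α β σ o} :=
    measurableSet_eq_fun measurable_lower measurable_upper
  simp only [Dtilde, mem_ofPred_eq, hσ, true_and, singletonOrbits_eq hα]
  exact (prob_compl_eq_zero_iff hm).symm

/-! ### Convergence in probability -/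

theorem tendstoInMeasure_X_iff (hα : 0 ≤ α) :
    TendstoInMeasure P (fun n θ => X α β σ n θ) atTop (fun _ => 0) ↔
      lower α β σ =ᵐ[Ptilde] upper α β σ := by
  have hpull : TendstoInMeasure P (fun n θ => X α β σ n θ) atTop (fun _ => 0) ↔
      TendstoInMeasure Ptilde (fun n o => pullIter α β σ ⊤ n o - pullIter α β σ ⊥ n o) atTop
        (fun _ => 0) := by
    refine forall_congr' fun ε => forall_congr' fun _ => ?_
    -- `pullIter` at index `n` composes `n + 1` maps, so it matches `X` at `n + 1`.
    rw [← tendsto_add_atTop_iff_nat 1]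
    refine iff_of_eq (congrArg (Tendsto · atTop (𝓝 0)) (funext fun n => ?_))
    have hX : Measurable (X α β σ (n + 1)) :=
      (measurable_iterVal n ⊤).sub (measurable_iterVal n ⊥)
    exact ((measurePreserving_eval (-((n + 1 : ℕ) : ℤ))).measure_preimage
      (measurableSet_le measurable_const (hX.edist measurable_const)).nullMeasurableSet).symm
  have hlim : TendstoInMeasure Ptilde
      (fun n o => pullIter α β σ ⊤ n o - pullIter α β σ ⊥ n o) atTop
      (fun o => upper α β σ o - lower α β σ o) :=
    tendstoInMeasure_of_tendsto_ae
      (fun n => ((measurable_pullIter ⊤ n).sub (measurable_pullIter ⊥ n)).aestronglyMeasurable)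
      (ae_of_all _ fun o => (tendsto_upper hα o).sub (tendsto_lower hα o))
  rw [hpull]
  constructor
  · intro h
    filter_upwards [tendstoInMeasure_ae_unique hlim h] with o ho
    exact (sub_eq_zero.mp ho).symm
  · intro h
    refine hlim.congr_right ?_
    filter_upwards [h] with o ho
    exact sub_eq_zero.mpr ho.symm

/-! ### Invariant measures -/

theorem isInvariantOver_map {u : Orbit → ℝ} (hm : Measurable u) (hu : IsEquivariant α β σ u) :
    IsInvariantOver α β σ (Ptilde.map fun o => (u o, o.1 0)) := by
  have hp : Measurable fun o : Orbit => (u o, o.1 0) := hm.prodMk (measurable_eval 0)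
  refine ⟨⟨measurable_G, ?_⟩, ?_⟩
  · have hc : G α β σ ∘ (fun o : Orbit => (u o, o.1 0)) =
        (fun o : Orbit => (u o, o.1 0)) ∘ shift 1 := funext fun o =>
      Prod.ext (hu o).symm (o.2 0).symm
    rw [Measure.map_map measurable_G hp, hc, ← Measure.map_map hp (measurable_shift 1),
      (measurePreserving_shift 1).map_eq]
  · rw [Measure.map_map measurable_snd hp]
    exact Ptilde_spec.2 0

theorem muD_eq (hα : 0 ≤ α) (h : lower α β σ =ᵐ[Ptilde] upper α β σ) :
    muD α β σ = Ptilde.map fun o => (upper α β σ o, o.1 0) := by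
  refine Measure.map_congr ?_
  filter_upwards [h] with o ho
  rw [a_eq_upper hα ho]

/-- Ordered functions with equal integrals agree almost everywhere. Composing with the bounded,
strictly increasing `arctan` makes integrability immediate and loses nothing. -/
theorem ae_eq_of_map_eq (hα : 0 ≤ α)
    (h : (Ptilde.map fun o => (lower α β σ o, o.1 0)) =
      Ptilde.map fun o => (upper α β σ o, o.1 0)) :
    lower α β σ =ᵐ[Ptilde] upper α β σ := by
  have hl : Measurable fun o : Orbit => (lower α β σ o, o.1 0) :=
    measurable_lower.prodMk (measurable_eval 0)
  have hu : Measurable fun o : Orbit => (upper α β σ o, o.1 0) :=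
    measurable_upper.prodMk (measurable_eval 0)
  have harc : Measurable fun p : ℝ × Circ => Real.arctan p.1 :=
    Real.measurable_arctan.comp measurable_fst
  have hint : ∀ u : Orbit → ℝ, Measurable u →
      Integrable (fun o => Real.arctan (u o)) Ptilde := fun u hm =>
    Integrable.of_bound (Real.measurable_arctan.comp hm).aestronglyMeasurable (Real.pi / 2)
      (ae_of_all _ fun o => abs_le.mpr
        ⟨(Real.neg_pi_div_two_lt_arctan _).le, (Real.arctan_lt_pi_div_two _).le⟩)
  have hi : ∫ o, Real.arctan (lower α β σ o) ∂Ptilde =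
      ∫ o, Real.arctan (upper α β σ o) ∂Ptilde := by
    have := congrArg (fun m : Measure (ℝ × Circ) => ∫ p, Real.arctan p.1 ∂m) h
    simpa only [integral_map hl.aemeasurable harc.aestronglyMeasurable,
      integral_map hu.aemeasurable harc.aestronglyMeasurable] using this
  have hae := (integral_eq_iff_of_ae_le (hint _ measurable_lower) (hint _ measurable_upper)
    (ae_of_all _ fun o => Real.arctan_strictMono.monotone (lower_le_upper hα o))).mp hi
  filter_upwards [hae] with o ho
  exact Real.arctan_injective ho

/-- Complements turn the bound on right rays into the reverse bound on closed left rays. Exhausting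
an open left ray by closed ones then gives equality. -/
theorem eq_of_measure_Iio_le_of_measure_Ioi_le {ρ m : Measure ℝ} [IsFiniteMeasure ρ] [IsFiniteMeasure m]
    (huniv : ρ univ = m univ) (hlt : ∀ t, m (Iio t) ≤ ρ (Iio t))
    (hgt : ∀ t, m (Ioi t) ≤ ρ (Ioi t)) : m = ρ := by
  have hIic : ∀ t, ρ (Iic t) ≤ m (Iic t) := fun t => by
    rw [← compl_Ioi, measure_compl measurableSet_Ioi (measure_ne_top _ _),
      measure_compl measurableSet_Ioi (measure_ne_top _ _), huniv]
    exact tsub_le_tsub_left (hgt t) _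
  refine Measure.ext_of_Ici m ρ fun t => ?_
  have hIio : m (Iio t) = ρ (Iio t) := by
    refine le_antisymm (hlt t) ?_
    obtain ⟨s, hs, hst, hlim⟩ := exists_seq_strictMono_tendsto t
    have hU : Iio t = ⋃ n, Iic (s n) := by
      ext y
      simp only [mem_Iio, mem_iUnion, mem_Iic]
      exact ⟨fun hy => ((hlim.eventually (lt_mem_nhds hy)).exists).imp fun _ => le_of_lt,
        fun ⟨n, hn⟩ => hn.trans_lt (hst n)⟩
    have hmono : Monotone fun n => Iic (s n) := fun i j hij => Iic_subset_Iic.mpr (hs.monotone hij)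
    rw [hU, hmono.measure_iUnion]
    exact iSup_le fun n => (hIic (s n)).trans (measure_mono (subset_iUnion (fun n => Iic (s n)) n))
  rw [← compl_Iio, measure_compl measurableSet_Iio (measure_ne_top _ _),
    measure_compl measurableSet_Iio (measure_ne_top _ _), huniv, hIio]

/-- Over each base point in `S` the entire real fibre is carried into `B ×ˢ A`. The mass of these
fibres depends only on the marginal `P`, and invariance of `μ` bounds it by the mass of the target.
This will be used with `x = ±∞` and `B` a ray. -/
theorem measure_pullIter_le_of_forall_subset {μ : Measure (ℝ × Circ)}
    (hμ : IsInvariantOver α β σ μ) {B : Set ℝ} {A : Set Circ} (hB : MeasurableSet B)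
    (hA : MeasurableSet A) {x : EReal} {n : ℕ}
    (h : ∀ (θ : Circ) (y : ℝ), iterVal α β σ n θ x ∈ B → iterVal α β σ n θ y ∈ B) :
    Ptilde {o | pullIter α β σ x n o ∈ B ∧ o.1 0 ∈ A} ≤ μ (B ×ˢ A) := by
  let S : Set Circ := {θ | iterVal α β σ n θ x ∈ B ∧ g^[n + 1] θ ∈ A}
  have hS : MeasurableSet S :=
    (measurable_iterVal n x hB).inter ((continuous_g.iterate (n + 1)).measurable hA)
  calc Ptilde {o | pullIter α β σ x n o ∈ B ∧ o.1 0 ∈ A}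
      = Ptilde ((fun o : Orbit => o.1 (-((n + 1 : ℕ) : ℤ))) ⁻¹' S) := by
        congr 1
        ext o
        simp only [S, mem_ofPred_eq, mem_preimage, ← orbit_iterate, neg_add_cancel]
        rfl
    _ = P S := (measurePreserving_eval _).measure_preimage hS.nullMeasurableSet
    _ = μ (Prod.snd ⁻¹' S) := by rw [← hμ.2, Measure.map_apply measurable_snd hS]
    _ ≤ μ ((G α β σ)^[n + 1] ⁻¹' (B ×ˢ A)) := by
        refine measure_mono fun p hp => ?_
        rw [mem_preimage, iterate_G]
        exact ⟨h _ _ hp.1, hp.2⟩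
    _ = μ (B ×ˢ A) :=
        (hμ.1.iterate (n + 1)).measure_preimage (hB.prod hA).nullMeasurableSet

theorem map_upper_Iio_le (hα : 0 ≤ α) {μ : Measure (ℝ × Circ)} (hμ : IsInvariantOver α β σ μ)
    {A : Set Circ} (hA : MeasurableSet A) (t : ℝ) :
    (Ptilde.map fun o => (upper α β σ o, o.1 0)) (Iio t ×ˢ A) ≤ μ (Iio t ×ˢ A) := by
  rw [Measure.map_apply (measurable_upper.prodMk (measurable_eval 0)) (measurableSet_Iio.prod hA)]
  have hU : (fun o : Orbit => (upper α β σ o, o.1 0)) ⁻¹' (Iio t ×ˢ A) =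
      ⋃ n, {o | pullIter α β σ ⊤ n o ∈ Iio t ∧ o.1 0 ∈ A} := by
    ext o
    simp only [mem_preimage, mem_prod, mem_iUnion, mem_ofPred_eq, exists_and_right, mem_Iio]
    refine and_congr_left fun _ => ⟨fun h => ?_, fun ⟨n, hn⟩ => ?_⟩
    · exact ((tendsto_upper hα o).eventually (gt_mem_nhds h)).exists
    · exact (ciInf_le (bddBelow_range_pullIter ⊤ o) n).trans_lt hn
  -- The upper ends decrease, so these events increase and the bound for each `n` passes to their
  -- union.
  have hmono : Monotone fun n => {o : Orbit | pullIter α β σ ⊤ n o ∈ Iio t ∧ o.1 0 ∈ A} :=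
    fun i j hij o ho => ⟨(antitone_pullIter_top hα o hij).trans_lt ho.1, ho.2⟩
  rw [hU, hmono.measure_iUnion]
  exact iSup_le fun n => measure_pullIter_le_of_forall_subset hμ measurableSet_Iio hA
    fun θ y hy => (monotone_iterVal hα n θ le_top).trans_lt hy

theorem map_lower_Ioi_le (hα : 0 ≤ α) {μ : Measure (ℝ × Circ)} (hμ : IsInvariantOver α β σ μ)
    {A : Set Circ} (hA : MeasurableSet A) (t : ℝ) :
    (Ptilde.map fun o => (lower α β σ o, o.1 0)) (Ioi t ×ˢ A) ≤ μ (Ioi t ×ˢ A) := by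
  rw [Measure.map_apply (measurable_lower.prodMk (measurable_eval 0)) (measurableSet_Ioi.prod hA)]
  have hU : (fun o : Orbit => (lower α β σ o, o.1 0)) ⁻¹' (Ioi t ×ˢ A) =
      ⋃ n, {o | pullIter α β σ ⊥ n o ∈ Ioi t ∧ o.1 0 ∈ A} := by
    ext o
    simp only [mem_preimage, mem_prod, mem_iUnion, mem_ofPred_eq, exists_and_right, mem_Ioi]
    refine and_congr_left fun _ => ⟨fun h => ?_, fun ⟨n, hn⟩ => ?_⟩
    · exact ((tendsto_lower hα o).eventually (lt_mem_nhds h)).exists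
    · exact hn.trans_le (le_ciSup (bddAbove_range_pullIter ⊥ o) n)
  have hmono : Monotone fun n => {o : Orbit | pullIter α β σ ⊥ n o ∈ Ioi t ∧ o.1 0 ∈ A} :=
    fun i j hij o ho => ⟨lt_of_lt_of_le ho.1 (monotone_pullIter_bot hα o hij), ho.2⟩
  rw [hU, hmono.measure_iUnion]
  exact iSup_le fun n => measure_pullIter_le_of_forall_subset hμ measurableSet_Ioi hA
    fun θ y hy => lt_of_lt_of_le hy (monotone_iterVal hα n θ bot_le)

theorem IsInvariantOver.isProbabilityMeasure {μ : Measure (ℝ × Circ)}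
    (hμ : IsInvariantOver α β σ μ) : IsProbabilityMeasure μ := by
  refine ⟨?_⟩
  rw [← preimage_univ (f := (Prod.snd : ℝ × Circ → Circ)),
    ← Measure.map_apply measurable_snd .univ, hμ.2, measure_univ]

theorem IsInvariantOver.measure_univ_prod {μ : Measure (ℝ × Circ)}
    (hμ : IsInvariantOver α β σ μ) {A : Set Circ} (hA : MeasurableSet A) :
    μ (univ ×ˢ A) = P A := by
  rw [← hμ.2, Measure.map_apply measurable_snd hA, univ_prod]

theorem IsInvariantOver.eq_map_upper (hα : 0 ≤ α) {μ : Measure (ℝ × Circ)}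
    (hμ : IsInvariantOver α β σ μ) (h : lower α β σ =ᵐ[Ptilde] upper α β σ) :
    μ = Ptilde.map fun o => (upper α β σ o, o.1 0) := by
  have hν := isInvariantOver_map measurable_upper (isEquivariant_upper (β := β) (σ := σ) hα)
  have hlu : (Ptilde.map fun o => (lower α β σ o, o.1 0)) =
      Ptilde.map fun o => (upper α β σ o, o.1 0) :=
    Measure.map_congr (h.mono fun o ho => by simp only [ho])
  have hgt := fun {A : Set Circ} (hA : MeasurableSet A) => map_lower_Ioi_le hα hμ hA
  rw [hlu] at hgt
  have hlt := fun {A : Set Circ} (hA : MeasurableSet A) => map_upper_Iio_le hα hμ hA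
  set ν := Ptilde.map fun o => (upper α β σ o, o.1 0)
  have := hμ.isProbabilityMeasure
  have := hν.isProbabilityMeasure
  -- Fixing `A` reduces the comparison to measures on `ℝ` of equal total mass `P A`, so
  -- disintegration is not needed.
  have hfib : ∀ (m : Measure (ℝ × Circ)) (A : Set Circ) (B : Set ℝ), MeasurableSet B →
      (m.restrict (Prod.snd ⁻¹' A)).map Prod.fst B = m (B ×ˢ A) := fun m A B hB => by
    rw [Measure.map_apply measurable_fst hB, Measure.restrict_apply (measurable_fst hB),
      Set.prod_eq]
  refine Measure.ext_prod fun {B A} hB hA => ?_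
  rw [← hfib μ A B hB, ← hfib ν A B hB]
  suffices heq : (ν.restrict (Prod.snd ⁻¹' A)).map Prod.fst =
      (μ.restrict (Prod.snd ⁻¹' A)).map Prod.fst by rw [heq]
  refine eq_of_measure_Iio_le_of_measure_Ioi_le ?_ (fun t => ?_) fun t => ?_
  · rw [hfib _ _ _ .univ, hfib _ _ _ .univ, hμ.measure_univ_prod hA, hν.measure_univ_prod hA]
  · rw [hfib _ _ _ measurableSet_Iio, hfib _ _ _ measurableSet_Iio]
    exact hlt hA t
  · rw [hfib _ _ _ measurableSet_Ioi, hfib _ _ _ measurableSet_Ioi]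
    exact hgt hA t

end ForcedMap

end

theorem propositionA6 (α : ℝ) (hα : 1 < α) (β σ : ℝ) (hσ : 0 ≤ σ) :
    List.TFAE
      [(β, σ) ∈ ForcedMap.Dtilde α,
       TendstoInMeasure ForcedMap.P (fun n θ => ForcedMap.X α β σ n θ) atTop (fun _ => 0),
       ∃! μ : Measure (ℝ × ForcedMap.Circ), ForcedMap.IsInvariantOver α β σ μ] ∧
    ((β, σ) ∈ ForcedMap.Dtilde α →
      ForcedMap.IsInvariantOver α β σ (ForcedMap.muD α β σ) ∧
      ∀ μ : Measure (ℝ × ForcedMap.Circ), ForcedMap.IsInvariantOver α β σ μ →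
        μ = ForcedMap.muD α β σ) := by
  have h0 : 0 ≤ α := by linarith
  have hU := ForcedMap.isInvariantOver_map ForcedMap.measurable_upper
    (ForcedMap.isEquivariant_upper (β := β) (σ := σ) h0)
  have hL := ForcedMap.isInvariantOver_map ForcedMap.measurable_lower
    (ForcedMap.isEquivariant_lower (β := β) (σ := σ) h0)
  have hmain : (β, σ) ∈ ForcedMap.Dtilde α →
      ForcedMap.IsInvariantOver α β σ (ForcedMap.muD α β σ) ∧
      ∀ μ : Measure (ℝ × ForcedMap.Circ), ForcedMap.IsInvariantOver α β σ μ →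
        μ = ForcedMap.muD α β σ := fun h => by
    rw [ForcedMap.mem_Dtilde_iff h0 hσ] at h
    rw [ForcedMap.muD_eq h0 h]
    exact ⟨hU, fun μ hμ => hμ.eq_map_upper h0 h⟩
  refine ⟨?_, hmain⟩
  tfae_have 1 ↔ 2 := by
    rw [ForcedMap.mem_Dtilde_iff h0 hσ, ForcedMap.tendstoInMeasure_X_iff h0]
  tfae_have 1 → 3 := fun h => ⟨_, (hmain h).1, (hmain h).2⟩
  tfae_have 3 → 1 := fun h =>
    (ForcedMap.mem_Dtilde_iff h0 hσ).mpr (ForcedMap.ae_eq_of_map_eq h0 (h.unique hL hU))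
  tfae_finish
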